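/- Let $\mathcal X$ be a finite set and let $q=q_{X,Y}$ be a probability mass function on $\mathcal X\times\mathcal X$ such that $X=Y$ almost surely under $q$. Consider the following two-processor simulation problem with an omniscient coordinator. For real rates $R,R_1,R_2\ge 0$ and a block length $n$, let $W_1,W_2$ be independent, with $W_i$ uniformly distributed on $[1:2^{nR_i}]$, where $[1:2^{a}]$ denotes the set of integers $m$ with $1\le m\le 2^{a}$. An $(n,2^{nR},2^{nR_1},2^{nR_2})$ simulation code consists of conditional probability mass functions $p(m|w_1,w_2)$, $p(x^n|m,w_1)$ and $p(y^n|m,w_2)$, with $m\in[1:2^{nR}]$, $w_i\in[1:2^{nR_i}]$ and $x^n,y^n\in\mathcal X^n$: the coordinator observes $(W_1,W_2)$ and sends a common message $M$ to both processors, and the first (second) processor, which sees only $M$ and $W_1$ (only $M$ and $W_2$), outputs $X^n$ ($Y^n$). The induced distribution of the outputs is $$p^{\mathrm{(induced)}}_{X^n,Y^n}(x^n,y^n)=\frac{1}{|[1:2^{nR_1}]|\,|[1:2^{nR_2}]|}\sum_{w_1,w_2,m}p(m|w_1,w_2)\,p(x^n|m,w_1)\,p(y^n|m,w_2).$$ A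 triple $(R,R_1,R_2)$ of non-negative reals is achievable if there is a sequence of $(n,2^{nR},2^{nR_1},2^{nR_2})$ simulation codes such that $$\lim_{n\to\infty}\bigl\|p^{\mathrm{(induced)}}_{X^n,Y^n}-q^{(n)}_{X,Y}\bigr\|_1=0,\qquad q^{(n)}_{X,Y}(x^n,y^n)=\prod_{i=1}^n q(x_i,y_i),$$ and the simulation rate region is the closure in $\mathbb R^3$ of the set of achievable triples. Theorem. The simulation rate region is the set of all triples $(R,R_1,R_2)$ of non-negative real numbers such that $$R+\min\{R_1,R_2\}\ge H(X)\qquad\text{and}\qquad R\ge \frac{H(X)}{2},$$ where $H(X)$ is the Shannon entropy, in bits, of the marginal of $X$ under $q$. -/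

import Mathlib

open Filter Topology

namespace DistributedSampling

noncomputable section

/-- The size of the index set `[1 : 2^{nR}]`, that is, the number of integers `m` with
`1 ≤ m ≤ 2^{nR}`. -/
def indexSize (n : ℕ) (R : ℝ) : ℕ := ⌊(2 : ℝ) ^ ((n : ℝ) * R)⌋₊

/-- The set `[1 : 2^{nR}]`, relabelled to start at zero. -/
abbrev Index (n : ℕ) (R : ℝ) : Type := Fin (indexSize n R)

/-- An `(n, 2^{nR}, 2^{nR₁}, 2^{nR₂})` simulation code for a coordinator that sees both sources of
shared randomness `W₁, W₂` and two processors, where processor `i` sees the common message and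
`Wᵢ` only. All three maps are random maps, which models private randomization. -/
structure SimulationCode (α β : Type*) (n : ℕ) (R R₁ R₂ : ℝ) where
  /-- The conditional law `p(m | w₁, w₂)` of the coordinator's message. -/
  coordinator : Index n R₁ → Index n R₂ → PMF (Index n R)
  /-- The conditional law `p(xⁿ | m, w₁)` of the output of processor 1. -/
  processor₁ : Index n R → Index n R₁ → PMF (Fin n → α)
  /-- The conditional law `p(yⁿ | m, w₂)` of the output of processor 2. -/
  processor₂ : Index n R → Index n R₂ → PMF (Fin n → β)

/-- The induced probability mass `p(xⁿ, yⁿ)` of a pair of outputs, when `W₁` and `W₂` are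
independent and uniformly distributed on their index sets. -/
def SimulationCode.induced {α β : Type*} {n : ℕ} {R R₁ R₂ : ℝ}
    (c : SimulationCode α β n R R₁ R₂) (x : Fin n → α) (y : Fin n → β) : ℝ :=
  ∑ w₁ : Index n R₁, ∑ w₂ : Index n R₂, ∑ m : Index n R,
    (c.coordinator w₁ w₂ m).toReal * (c.processor₁ m w₁ x).toReal * (c.processor₂ m w₂ y).toReal
      / ((indexSize n R₁ : ℝ) * (indexSize n R₂ : ℝ))

/-- The i.i.d. probability mass `∏ᵢ q(xᵢ, yᵢ)`. -/
def iidMass {α β : Type*} (q : PMF (α × β)) {n : ℕ} (x : Fin n → α) (y : Fin n → β) : ℝ :=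
  ∏ i, (q (x i, y i)).toReal

/-- The `ℓ¹` distance between the induced distribution of a code and the i.i.d. distribution. -/
def SimulationCode.l1Error {α β : Type*} [Fintype α] [Fintype β] {n : ℕ} {R R₁ R₂ : ℝ}
    (c : SimulationCode α β n R R₁ R₂) (q : PMF (α × β)) : ℝ :=
  ∑ x : Fin n → α, ∑ y : Fin n → β, |c.induced x y - iidMass q x y|

/-- The rate triple `(R, R₁, R₂)` is achievable for `q`: rates are non-negative, and there is a
sequence of simulation codes, one for each block length `n`, with vanishing `ℓ¹` error. -/
def Achievable {α β : Type*} [Fintype α] [Fintype β] (q : PMF (α × β)) (R R₁ R₂ : ℝ) : Prop :=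
  0 ≤ R ∧ 0 ≤ R₁ ∧ 0 ≤ R₂ ∧
    ∃ c : (n : ℕ) → SimulationCode α β n R R₁ R₂,
      Tendsto (fun n => (c n).l1Error q) atTop (𝓝 0)

/-- The simulation rate region: the closure of the set of achievable triples `(R, R₁, R₂)`. -/
def simulationRateRegion {α β : Type*} [Fintype α] [Fintype β] (q : PMF (α × β)) :
    Set (ℝ × ℝ × ℝ) :=
  closure {r | Achievable q r.1 r.2.1 r.2.2}

/-- Shannon entropy in bits. A term with `p a = 0` contributes `0`. -/
def entropy {α : Type*} [Fintype α] (p : PMF α) : ℝ :=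
  -∑ a, (p a).toReal * Real.logb 2 (p a).toReal

end

end DistributedSampling

/-!
Write `p` for the law of `X` and `H` for its entropy.

*Converse.* Once `p(m|w₁,w₂)` is bounded by one, each of the `2^{nR}` messages contributes to the
diagonal of the induced law a product `a(x) b(x)` of two mass functions, so by Cauchy–Schwarz the
square roots of the diagonal entries sum to at most `2^{nR}`. As the output of processor `i` is
drawn from one of `2^{n(R + Rᵢ)}` laws, indexed by the pairs `(m, wᵢ)`, a similar argument bounds
the sum by `2^{n(R + Rᵢ)/2}`. But the square roots of the masses of `pⁿ` sum to at least about
`2^{nH/2}`, and approximation in `ℓ¹` cannot lower this order. Hence `H / 2` is at most `R` and at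
most `(R + Rᵢ) / 2`.

*Achievability.* Let `t = min {R, R₁, R₂}`, reduce `W₁` and `W₂` modulo `k ≈ 2^{nt}`, and send the
sum of the two residues together with a fresh uniform variable of rate `s = R - t`. Each processor
subtracts its own residue and then knows both, so the two share `s + 2t = min (2R) (R + min R₁ R₂)`
random bits per letter. If this exceeds `H`, a common function of these bits approximates `pⁿ`.
-/

namespace DistributedSampling

open Finset
open scoped BigOperators

variable {α β A B S : Type*}

/-! ### Probability mass functions as real weights -/

theorem sum_toReal_pmf [Fintype A] (p : PMF A) : ∑ a, (p a).toReal = 1 := by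
  rw [← ENNReal.toReal_sum fun a _ => p.apply_ne_top a, ← tsum_fintype (L := .unconditional A),
    p.tsum_coe, ENNReal.toReal_one]

theorem toReal_pmf_le_one (p : PMF A) (a : A) : (p a).toReal ≤ 1 :=
  ENNReal.toReal_le_of_le_ofReal zero_le_one (by simpa using p.coe_le_one a)

theorem toReal_pure [DecidableEq A] (a b : A) :
    (PMF.pure a b).toReal = if b = a then 1 else 0 := by
  rw [PMF.pure_apply]
  split_ifs <;> simp only [ENNReal.toReal_one, ENNReal.toReal_zero]

theorem toReal_map [Fintype A] [DecidableEq S] (p : PMF A) (f : A → S) (s : S) :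
    (p.map f s).toReal = ∑ a with f a = s, (p a).toReal := by
  classical
  rw [← ENNReal.toReal_sum fun a _ => p.apply_ne_top a, PMF.map_apply, tsum_fintype, sum_filter]
  congr! 3
  exact eq_comm

theorem sum_toReal_map_mul [Fintype A] [Fintype S] (p : PMF A) (f : A → S) (F : S → ℝ) :
    ∑ s, (p.map f s).toReal * F s = ∑ a, (p a).toReal * F (f a) := by
  classical
  simp only [toReal_map, sum_mul]
  rw [← sum_fiberwise univ f]
  refine sum_congr rfl fun s _ => sum_congr rfl fun a ha => ?_
  rw [(mem_filter.1 ha).2]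

theorem sum_toReal_uniformOfFintype_mul [Fintype A] [Nonempty A] (F : A → ℝ) :
    ∑ a, (PMF.uniformOfFintype A a).toReal * F a = 𝔼 a, F a := by
  simp only [PMF.uniformOfFintype_apply, ENNReal.toReal_inv, ENNReal.toReal_natCast, ← mul_sum]
  rw [Fintype.expect_eq_sum_div_card, inv_mul_eq_div]

theorem toReal_map_uniformOfFintype [Fintype A] [Nonempty A] [DecidableEq S] (f : A → S) (s : S) :
    ((PMF.uniformOfFintype A).map f s).toReal = 𝔼 a, if f a = s then (1 : ℝ) else 0 := by
  rw [toReal_map, ← sum_toReal_uniformOfFintype_mul, sum_filter]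
  simp only [mul_ite, mul_one, mul_zero]

theorem toReal_map_prodMap_uniformOfFintype {T : Type*} [Fintype A] [Nonempty A] [Fintype B]
    [Nonempty B] (f : A → S) (g : B → T) (s : S) (t : T) :
    ((PMF.uniformOfFintype (A × B)).map (Prod.map f g) (s, t)).toReal =
      ((PMF.uniformOfFintype A).map f s).toReal * ((PMF.uniformOfFintype B).map g t).toReal := by
  classical
  simp only [toReal_map_uniformOfFintype, expect_mul_expect, ← expect_product', univ_product_univ]
  refine expect_congr rfl fun x _ => ?_
  simp only [Prod.map, Prod.mk.injEq, ite_and, ite_mul, one_mul, zero_mul]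

theorem sum_expect_toReal_le_one {ι : Type*} [Fintype ι] [Fintype A] (p : ι → PMF A) :
    ∑ a, 𝔼 i, (p i a).toReal ≤ 1 := by
  rw [← expect_sum_comm]
  simp only [sum_toReal_pmf, Fintype.expect_eq_sum_div_card, sum_const, card_univ, nsmul_eq_mul,
    mul_one]
  exact div_self_le_one _

/-! ### Words of independent letters -/

section Words

variable [Fintype α]

/-- The law of a word of `n` independent letters with common law `p`: the `n`-fold product `pⁿ`. -/
noncomputable def iid (p : PMF α) (n : ℕ) : PMF (Fin n → α) :=
  PMF.ofFintype (fun x => ∏ i, p (x i)) <| by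
    rw [← Fintype.piFinset_univ, ← sum_pow', ← tsum_fintype (L := .unconditional α), p.tsum_coe,
      one_pow]

theorem toReal_iid (p : PMF α) {n : ℕ} (x : Fin n → α) :
    (iid p n x).toReal = ∏ i, (p (x i)).toReal := by
  rw [iid, PMF.ofFintype_apply, ENNReal.toReal_prod]

theorem logb_toReal_iid {p : PMF α} {n : ℕ} {x : Fin n → α} (hx : (iid p n x).toReal ≠ 0) :
    Real.logb 2 (iid p n x).toReal = ∑ i, Real.logb 2 (p (x i)).toReal := by
  rw [toReal_iid] at hx ⊢
  exact Real.logb_prod _ _ (prod_ne_zero_iff.1 hx)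

theorem exists_exponential_moment_lt_one {p : α → ℝ} (hp : ∑ a, p a = 1) {g : α → ℝ} {c : ℝ}
    (hc : ∑ a, p a * g a < c) :
    ∃ s : ℝ, 0 < s ∧ ∑ a, p a * Real.exp (s * (g a - c)) < 1 := by
  have hderiv : HasDerivAt (fun s : ℝ => ∑ a, p a * Real.exp (s * (g a - c)))
      (∑ a, p a * (g a - c)) 0 := by
    refine HasDerivAt.fun_sum fun a _ => ?_
    simpa using (((hasDerivAt_id (0 : ℝ)).mul_const (g a - c)).exp).const_mul (p a)
  have hneg : ∑ a, p a * (g a - c) < 0 := by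
    simpa only [mul_sub, sum_sub_distrib, ← sum_mul, hp, one_mul, sub_neg] using hc
  obtain ⟨s, hslope, hs⟩ := ((hderiv.tendsto_slope_zero_right.eventually
    (gt_mem_nhds hneg)).and self_mem_nhdsWithin).exists
  refine ⟨s, hs, ?_⟩
  simp only [zero_add, zero_mul, Real.exp_zero, mul_one, hp, smul_eq_mul] at hslope
  exact sub_neg.1 (neg_of_mul_neg_right hslope (inv_nonneg.2 hs.le))

/-- Chernoff's argument: on the event, `pⁿ(x)` is at most `pⁿ(x)` times the exponential
`∏ᵢ exp (s (g xᵢ - c)) ≥ 1`, whose mean is the `n`-th power of a number below one. -/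
theorem tendsto_sum_iid_of_imp_le_sum (p : PMF α) {g : α → ℝ} {c : ℝ}
    (hc : ∑ a, (p a).toReal * g a < c) {E : (n : ℕ) → (Fin n → α) → Prop}
    [∀ n, DecidablePred (E n)]
    (hE : ∀ n x, (iid p n x).toReal ≠ 0 → E n x → n * c ≤ ∑ i, g (x i)) :
    Tendsto (fun n => ∑ x with E n x, (iid p n x).toReal) atTop (𝓝 0) := by
  classical
  obtain ⟨s, hs, hlt⟩ := exists_exponential_moment_lt_one (sum_toReal_pmf p) hc
  refine squeeze_zero (fun n => sum_nonneg fun x _ => ENNReal.toReal_nonneg) (fun n => ?_)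
    (tendsto_pow_atTop_nhds_zero_of_lt_one (sum_nonneg fun a _ => by positivity) hlt)
  calc ∑ x with E n x, (iid p n x).toReal
      ≤ ∑ x with E n x, (iid p n x).toReal * ∏ i, Real.exp (s * (g (x i) - c)) := by
        refine sum_le_sum fun x hx => ?_
        rcases eq_or_ne (iid p n x).toReal 0 with h0 | h0
        · rw [h0, zero_mul]
        refine le_mul_of_one_le_right ENNReal.toReal_nonneg ?_
        rw [← Real.exp_sum, ← mul_sum, Real.one_le_exp_iff]
        simpa [hs] using hE n x h0 (mem_filter.1 hx).2
    _ ≤ ∑ x, (iid p n x).toReal * ∏ i, Real.exp (s * (g (x i) - c)) :=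
        sum_le_univ_sum_of_nonneg fun x => by positivity
    _ = (∑ a, (p a).toReal * Real.exp (s * (g a - c))) ^ n := by
        simp only [toReal_iid, ← prod_mul_distrib]
        rw [sum_pow', Fintype.piFinset_univ]

theorem tendsto_sum_iid_lt_rpow (p : PMF α) {c : ℝ} (hc : entropy p < c) :
    Tendsto (fun n : ℕ => ∑ x with (iid p n x).toReal < (2 : ℝ) ^ (-(n * c)),
      (iid p n x).toReal) atTop (𝓝 0) := by
  refine tendsto_sum_iid_of_imp_le_sum p (g := fun a => -Real.logb 2 (p a).toReal) (c := c)
    (by simpa [entropy] using hc) fun n x hx hlt => ?_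
  have hlog := Real.logb_lt_logb one_lt_two (ENNReal.toReal_nonneg.lt_of_ne' hx) hlt
  rw [Real.logb_rpow two_pos (by norm_num), logb_toReal_iid hx] at hlog
  rw [sum_neg_distrib]
  linarith

theorem tendsto_sum_iid_rpow_lt (p : PMF α) {c : ℝ} (hc : c < entropy p) :
    Tendsto (fun n : ℕ => ∑ x with (2 : ℝ) ^ (-(n * c)) < (iid p n x).toReal,
      (iid p n x).toReal) atTop (𝓝 0) := by
  refine tendsto_sum_iid_of_imp_le_sum p (g := fun a => Real.logb 2 (p a).toReal) (c := -c)
    (lt_neg.1 hc) fun n x hx hlt => ?_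
  have hlog := Real.logb_lt_logb one_lt_two (by positivity) hlt
  rw [Real.logb_rpow two_pos (by norm_num), logb_toReal_iid hx] at hlog
  linarith

end Words

/-! ### Quantization of a mass function -/

/-- By induction on `B`: if some target exceeds `δ`, its deficit absorbs the new atom; otherwise
nothing has to be matched. -/
theorem exists_le_sum_fiber_add [Fintype S] [Nonempty S] [DecidableEq S] {u : A → ℝ}
    (hu : ∀ a, 0 ≤ u a) {δ : ℝ} (hδ : 0 ≤ δ) (huδ : ∀ a, u a ≤ δ) (B : Finset A) {p : S → ℝ}
    (hp : ∀ s, 0 ≤ p s) (hpu : ∑ s, p s ≤ ∑ a ∈ B, u a) :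
    ∃ f : A → S, ∀ s, p s ≤ ∑ a ∈ B with f a = s, u a + δ := by
  classical
  induction B using Finset.induction_on generalizing p with
  | empty =>
    refine ⟨fun _ => Classical.arbitrary S, fun s => ?_⟩
    have hps : p s ≤ ∑ s, p s := single_le_sum (fun s _ => hp s) (mem_univ s)
    rw [sum_empty] at hpu
    rw [filter_empty, sum_empty]
    linarith
  | insert a B ha ih =>
    by_cases hall : ∀ s, p s ≤ δ
    · exact ⟨fun _ => Classical.arbitrary S, fun s =>
        (hall s).trans (le_add_of_nonneg_left (sum_nonneg fun a _ => hu a))⟩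
    push Not at hall
    obtain ⟨s₀, hs₀⟩ := hall
    obtain ⟨f, hf⟩ := ih (p := p - Pi.single s₀ (u a))
      (fun s => by
        rcases eq_or_ne s s₀ with rfl | hs
        · simpa using (huδ a).trans hs₀.le
        · simpa [hs] using hp s)
      (by
        rw [sum_insert ha] at hpu
        simp only [Pi.sub_apply, sum_sub_distrib, sum_pi_single', mem_univ, if_true]
        linarith)
    refine ⟨Function.update f a s₀, fun s => ?_⟩
    have hfiber : ∑ b ∈ B with Function.update f a s₀ b = s, u b = ∑ b ∈ B with f b = s, u b := by
      refine sum_congr (filter_congr fun b hb => ?_) fun _ _ => rfl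
      rw [Function.update_of_ne (ne_of_mem_of_not_mem hb ha)]
    have hs := hf s
    rw [filter_insert, Function.update_self]
    rcases eq_or_ne s s₀ with rfl | hne
    · rw [if_pos rfl, sum_insert (by simp [ha]), hfiber]
      simp only [Pi.sub_apply, Pi.single_eq_same] at hs
      linarith
    · rw [if_neg hne.symm, hfiber]
      simpa [hne] using hs

theorem exists_sum_abs_map_sub_le [Finite A] [Fintype S] (u : PMF A) (p : PMF S) {δ : ℝ}
    (hδ : ∀ a, (u a).toReal ≤ δ) :
    ∃ f : A → S, ∑ s, |(u.map f s).toReal - (p s).toReal| ≤ 2 * ∑ s, min δ (p s).toReal := by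
  classical
  cases nonempty_fintype A
  have : Nonempty S := p.support_nonempty.to_type
  obtain ⟨a₀, -⟩ := u.support_nonempty
  obtain ⟨f, hf⟩ := exists_le_sum_fiber_add (fun a => (ENNReal.toReal_nonneg : 0 ≤ (u a).toReal))
    (ENNReal.toReal_nonneg.trans (hδ a₀)) hδ univ (p := fun s => (p s).toReal)
    (fun s => ENNReal.toReal_nonneg) (by rw [sum_toReal_pmf, sum_toReal_pmf])
  refine ⟨f, ?_⟩
  have habs : ∀ s, |(u.map f s).toReal - (p s).toReal| ≤
      (u.map f s).toReal - (p s).toReal + 2 * min δ (p s).toReal := by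
    intro s
    have hle : (p s).toReal - (u.map f s).toReal ≤ min δ (p s).toReal :=
      le_min (by rw [toReal_map]; linarith [hf s]) (sub_le_self _ ENNReal.toReal_nonneg)
    have hmin : 0 ≤ min δ (p s).toReal :=
      le_min (ENNReal.toReal_nonneg.trans (hδ a₀)) ENNReal.toReal_nonneg
    rw [abs_le]
    constructor <;> linarith
  refine (sum_le_sum fun s _ => habs s).trans (le_of_eq ?_)
  rw [sum_add_distrib, sum_sub_distrib, sum_toReal_pmf, sum_toReal_pmf, sub_self, zero_add, mul_sum]

theorem sum_min_le_div_add [Fintype S] (p : PMF S) {δ t : ℝ} (hδ : 0 ≤ δ) (ht : 0 < t) :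
    ∑ s, min δ (p s).toReal ≤ δ / t + ∑ s with (p s).toReal < t, (p s).toReal := by
  calc ∑ s, min δ (p s).toReal
      ≤ ∑ s, (δ / t * (p s).toReal + if (p s).toReal < t then (p s).toReal else 0) := by
        refine sum_le_sum fun s _ => ?_
        split_ifs with hs
        · exact (min_le_right _ _).trans (le_add_of_nonneg_left (by positivity))
        · rw [add_zero, div_mul_eq_mul_div]
          refine (min_le_left _ _).trans ((le_div_iff₀ ht).2 ?_)
          exact mul_le_mul_of_nonneg_left (not_lt.1 hs) hδ
    _ = δ / t + ∑ s with (p s).toReal < t, (p s).toReal := by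
        rw [sum_add_distrib, ← mul_sum, sum_toReal_pmf, mul_one, sum_filter]

theorem tendsto_sum_min_iid [Fintype α] (p : PMF α) {b C : ℝ} (hb : entropy p < b) (hC : 0 ≤ C) :
    Tendsto (fun n : ℕ => ∑ x, min (C * 2 ^ (-(n * b))) (iid p n x).toReal) atTop (𝓝 0) := by
  obtain ⟨c, hc, hcb⟩ := exists_between hb
  have hpow : Tendsto (fun n : ℕ => C * ((2 : ℝ) ^ (c - b)) ^ n) atTop (𝓝 (C * 0)) :=
    (tendsto_pow_atTop_nhds_zero_of_lt_one (by positivity)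
      (Real.rpow_lt_one_of_one_lt_of_neg one_lt_two (sub_neg.2 hcb))).const_mul C
  have hlim := hpow.add (tendsto_sum_iid_lt_rpow p hc)
  rw [mul_zero, add_zero] at hlim
  refine squeeze_zero (fun n => sum_nonneg fun x _ => by positivity) (fun n => ?_) hlim
  refine (sum_min_le_div_add (t := 2 ^ (-(n * c))) (iid p n) (by positivity)
    (by positivity)).trans_eq ?_
  rw [mul_div_assoc, ← Real.rpow_sub two_pos, ← Real.rpow_natCast, ← Real.rpow_mul two_pos.le]
  ring_nf

/-! ### Square roots of mass functions -/

theorem sqrt_sum_le_sum_sqrt {ι : Type*} (s : Finset ι) (a : ι → ℝ) :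
    √(∑ i ∈ s, a i) ≤ ∑ i ∈ s, √(a i) := by
  refine le_sum_of_subadditive Real.sqrt Real.sqrt_zero.le (fun x y => ?_) s a
  refine Real.sqrt_le_iff.2 ⟨by positivity, ?_⟩
  have hx : x ≤ √x ^ 2 := (Real.sqrt_le_left (Real.sqrt_nonneg x)).1 le_rfl
  have hy : y ≤ √y ^ 2 := (Real.sqrt_le_left (Real.sqrt_nonneg y)).1 le_rfl
  have hxy : 0 ≤ √x * √y := by positivity
  linarith [add_sq (√x) (√y)]

theorem sum_sqrt_sum_mul_le {ι : Type*} [Fintype ι] [Fintype S] {a b : ι → S → ℝ}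
    (ha : ∀ i s, 0 ≤ a i s) (ha_sum : ∀ i, ∑ s, a i s ≤ 1) (hb : ∀ i s, 0 ≤ b i s) :
    ∑ s, √(∑ i, a i s * b i s) ≤ ∑ i, √(∑ s, b i s) := by
  calc ∑ s, √(∑ i, a i s * b i s) ≤ ∑ s, ∑ i, √(a i s * b i s) :=
        sum_le_sum fun s _ => sqrt_sum_le_sum_sqrt _ _
    _ = ∑ i, ∑ s, √(a i s) * √(b i s) := by
        simp only [Real.sqrt_mul (ha _ _)]
        exact sum_comm
    _ ≤ ∑ i, √(∑ s, a i s) * √(∑ s, b i s) :=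
        sum_le_sum fun i _ => Real.sum_sqrt_mul_sqrt_le _ (ha i) (hb i)
    _ ≤ ∑ i, √(∑ s, b i s) := sum_le_sum fun i _ =>
        mul_le_of_le_one_left (Real.sqrt_nonneg _) (Real.sqrt_le_one.2 (ha_sum i))

theorem sum_sqrt_le_sqrt_card_mul_sum {ι : Type*} [Fintype ι] {b : ι → ℝ} (hb : ∀ i, 0 ≤ b i) :
    ∑ i, √(b i) ≤ √(Fintype.card ι * ∑ i, b i) := by
  rw [Real.sqrt_mul (Nat.cast_nonneg _)]
  simpa using Real.sum_sqrt_mul_sqrt_le univ (f := fun _ => 1) (fun _ => zero_le_one) hb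

theorem le_abs_sub_add_sqrt_mul_sqrt {a b : ℝ} (ha : 0 ≤ a) (hb : 0 ≤ b) :
    a ≤ |b - a| + √a * √b := by
  rcases le_total a b with h | h
  · have hab : √a * √a ≤ √a * √b := by gcongr
    linarith [Real.mul_self_sqrt ha, abs_nonneg (b - a)]
  · have hab : √b * √b ≤ √a * √b := by gcongr
    linarith [Real.mul_self_sqrt hb, neg_abs_le (b - a)]

theorem sum_le_sum_heavy_add_sum_abs_sub_add [Fintype S] {p r : S → ℝ} (hp : ∀ s, 0 ≤ p s)
    (hr : ∀ s, 0 ≤ r s) (t : ℝ) :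
    ∑ s, p s ≤ ∑ s with t < p s, p s + ∑ s, |r s - p s| + √t * ∑ s, √(r s) := by
  rw [sum_filter, mul_sum, ← sum_add_distrib, ← sum_add_distrib]
  refine sum_le_sum fun s _ => ?_
  split_ifs with hs
  · have : 0 ≤ √t * √(r s) := by positivity
    linarith [abs_nonneg (r s - p s)]
  · have : √(p s) * √(r s) ≤ √t * √(r s) := by gcongr; exact not_lt.1 hs
    linarith [le_abs_sub_add_sqrt_mul_sqrt (hp s) (hr s)]

/-- Words of mass above `t ≈ 2^{-nH}` are negligible, and on all others `p ≤ |r - p| + √t √r`; so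
`√t ∑ √r` cannot vanish. -/
theorem entropy_div_two_le_of_sum_sqrt_le [Fintype α] (p : PMF α) {r : (n : ℕ) → (Fin n → α) → ℝ}
    (hr : ∀ n x, 0 ≤ r n x)
    (hrp : Tendsto (fun n => ∑ x, |r n x - (iid p n x).toReal|) atTop (𝓝 0)) {s : ℝ}
    (hs : ∀ n : ℕ, ∑ x, √(r n x) ≤ 2 ^ (n * s)) :
    entropy p / 2 ≤ s := by
  by_contra! hlt
  obtain ⟨h, hsh, hh⟩ := exists_between (show 2 * s < entropy p by linarith)
  have hpow : Tendsto (fun n : ℕ => ((2 : ℝ) ^ (s - h / 2)) ^ n) atTop (𝓝 0) :=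
    tendsto_pow_atTop_nhds_zero_of_lt_one (by positivity)
      (Real.rpow_lt_one_of_one_lt_of_neg one_lt_two (by linarith))
  have hlim := ((tendsto_sum_iid_rpow_lt p hh).add hrp).add hpow
  rw [add_zero, add_zero] at hlim
  refine zero_lt_one.not_ge (ge_of_tendsto' hlim fun n => ?_)
  have hsqrt : √((2 : ℝ) ^ (-(n * h))) * ∑ x, √(r n x) ≤ ((2 : ℝ) ^ (s - h / 2)) ^ n := by
    refine (mul_le_mul_of_nonneg_left (hs n) (Real.sqrt_nonneg _)).trans_eq ?_
    rw [Real.sqrt_eq_rpow, ← Real.rpow_mul two_pos.le, ← Real.rpow_add two_pos,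
      ← Real.rpow_natCast, ← Real.rpow_mul two_pos.le]
    ring_nf
  have hsum := sum_le_sum_heavy_add_sum_abs_sub_add (fun x => ENNReal.toReal_nonneg) (hr n)
    (2 ^ (-(n * h))) (p := fun x => (iid p n x).toReal)
  rw [sum_toReal_pmf] at hsum
  linarith

/-! ### Converse -/

theorem indexSize_pos {n : ℕ} {R : ℝ} (hR : 0 ≤ R) : 0 < indexSize n R :=
  Nat.floor_pos.2 (Real.one_le_rpow one_le_two (by positivity))

theorem indexSize_le (n : ℕ) (R : ℝ) : (indexSize n R : ℝ) ≤ 2 ^ (n * R) :=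
  Nat.floor_le (by positivity)

theorem indexSize_mul_indexSize_le (n : ℕ) (R R' : ℝ) :
    (indexSize n R * indexSize n R' : ℝ) ≤ 2 ^ (n * (R + R')) := by
  rw [mul_add, Real.rpow_add two_pos]
  exact mul_le_mul (indexSize_le n R) (indexSize_le n R') (Nat.cast_nonneg _) (by positivity)

namespace SimulationCode

variable {n : ℕ} {R R₁ R₂ : ℝ}

theorem induced_nonneg (c : SimulationCode α β n R R₁ R₂) (x : Fin n → α) (y : Fin n → β) :
    0 ≤ c.induced x y :=
  sum_nonneg fun _ _ => sum_nonneg fun _ _ => sum_nonneg fun _ _ => by positivity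

theorem induced_eq_expect (c : SimulationCode α β n R R₁ R₂) (x : Fin n → α) (y : Fin n → β) :
    c.induced x y = 𝔼 w₁, 𝔼 w₂, ∑ m, (c.coordinator w₁ w₂ m).toReal *
      (c.processor₁ m w₁ x).toReal * (c.processor₂ m w₂ y).toReal := by
  simp only [induced, Fintype.expect_eq_sum_div_card, Fintype.card_fin, sum_div, div_div,
    mul_comm (indexSize n R₁ : ℝ)]

/-- The code with the roles of the two processors exchanged, by which every bound for the first
processor also holds for the second. -/
def swap (c : SimulationCode α β n R R₁ R₂) : SimulationCode β α n R R₂ R₁ where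
  coordinator w₂ w₁ := c.coordinator w₁ w₂
  processor₁ := c.processor₂
  processor₂ := c.processor₁

theorem swap_induced (c : SimulationCode α β n R R₁ R₂) (x : Fin n → α) (y : Fin n → β) :
    c.swap.induced y x = c.induced x y := by
  rw [induced_eq_expect, induced_eq_expect, expect_comm]
  simp only [swap, mul_right_comm]

theorem induced_le_sum_mul (c : SimulationCode α β n R R₁ R₂) (x : Fin n → α) (y : Fin n → β) :
    c.induced x y ≤
      ∑ m, (𝔼 w₁, (c.processor₁ m w₁ x).toReal) * 𝔼 w₂, (c.processor₂ m w₂ y).toReal := by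
  simp only [induced_eq_expect, expect_mul_expect, ← expect_sum_comm]
  refine expect_le_expect fun w₁ _ => expect_le_expect fun w₂ _ => sum_le_sum fun m _ => ?_
  rw [mul_assoc]
  exact mul_le_of_le_one_left (by positivity) (toReal_pmf_le_one _ _)

theorem induced_eq_sum_mul (c : SimulationCode α β n R R₁ R₂) (x : Fin n → α) (y : Fin n → β) :
    c.induced x y = ∑ i : Index n R × Index n R₁, (c.processor₁ i.1 i.2 x).toReal *
      ((𝔼 w₂, (c.coordinator i.2 w₂ i.1).toReal * (c.processor₂ i.1 w₂ y).toReal) /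
        indexSize n R₁) := by
  rw [induced_eq_expect, Fintype.expect_eq_sum_div_card, Fintype.card_fin, sum_div,
    Fintype.sum_prod_type_right]
  refine sum_congr rfl fun w₁ _ => ?_
  rw [expect_sum_comm, sum_div]
  refine sum_congr rfl fun m _ => ?_
  rw [mul_div_assoc', mul_expect]
  simp only [mul_left_comm, mul_assoc]

variable [Fintype α]

theorem sum_expect_coordinator_mul_processor₂_le_one (c : SimulationCode β α n R R₁ R₂) :
    ∑ i : Index n R × Index n R₁, ∑ y, (𝔼 w₂, (c.coordinator i.2 w₂ i.1).toReal *
      (c.processor₂ i.1 w₂ y).toReal) / indexSize n R₁ ≤ 1 := by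
  have hmarg : ∀ i : Index n R × Index n R₁, ∑ y, (𝔼 w₂, (c.coordinator i.2 w₂ i.1).toReal *
      (c.processor₂ i.1 w₂ y).toReal) / indexSize n R₁ =
        (𝔼 w₂, (c.coordinator i.2 w₂ i.1).toReal) / indexSize n R₁ := fun i => by
    rw [← sum_div, ← expect_sum_comm]
    simp only [← mul_sum, sum_toReal_pmf, mul_one]
  simp only [hmarg]
  rw [Fintype.sum_prod_type_right]
  simp only [← sum_div]
  refine div_le_one_of_le₀ ?_ (Nat.cast_nonneg _)
  refine (sum_le_sum fun w₁ _ => sum_expect_toReal_le_one fun w₂ => c.coordinator w₁ w₂).trans ?_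
  simp

theorem sum_sqrt_induced_le_message (c : SimulationCode α α n R R₁ R₂) :
    ∑ x, √(c.induced x x) ≤ indexSize n R := by
  refine (sum_le_sum fun x _ => Real.sqrt_le_sqrt (c.induced_le_sum_mul x x)).trans ?_
  refine (sum_sqrt_sum_mul_le (fun m x => expect_nonneg fun w _ => ENNReal.toReal_nonneg)
    (fun m => sum_expect_toReal_le_one _)
    (fun m x => expect_nonneg fun w _ => ENNReal.toReal_nonneg)).trans ?_
  refine (sum_le_sum fun m _ => Real.sqrt_le_one.2 (sum_expect_toReal_le_one _)).trans ?_
  simp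

theorem sum_sqrt_induced_le_processor₁ (c : SimulationCode α α n R R₁ R₂) :
    ∑ x, √(c.induced x x) ≤ √(indexSize n R * indexSize n R₁) := by
  have hnonneg : ∀ (i : Index n R × Index n R₁) x, 0 ≤ (𝔼 w₂, (c.coordinator i.2 w₂ i.1).toReal *
      (c.processor₂ i.1 w₂ x).toReal) / indexSize n R₁ := fun i x =>
    div_nonneg (expect_nonneg fun w _ => by positivity) (Nat.cast_nonneg _)
  simp only [induced_eq_sum_mul]
  refine (sum_sqrt_sum_mul_le (fun i x => ENNReal.toReal_nonneg)
    (fun i => (sum_toReal_pmf _).le) hnonneg).trans ?_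
  refine (sum_sqrt_le_sqrt_card_mul_sum fun i => sum_nonneg fun x _ => hnonneg i x).trans ?_
  rw [Fintype.card_prod, Fintype.card_fin, Fintype.card_fin, Nat.cast_mul]
  exact Real.sqrt_le_sqrt (mul_le_of_le_one_right (by positivity)
    c.sum_expect_coordinator_mul_processor₂_le_one)

theorem sum_sqrt_induced_le_processor₂ (c : SimulationCode α α n R R₁ R₂) :
    ∑ x, √(c.induced x x) ≤ √(indexSize n R * indexSize n R₂) := by
  simpa only [swap_induced] using c.swap.sum_sqrt_induced_le_processor₁

end SimulationCode

section Diagonal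

variable {q : PMF (α × α)}

theorem apply_eq_ite_map_fst [DecidableEq α] (hq : ∀ x y : α, q (x, y) ≠ 0 → x = y) (a b : α) :
    q (a, b) = if a = b then q.map Prod.fst a else 0 := by
  have hoff : ∀ {a b}, a ≠ b → q (a, b) = 0 := fun hab => of_not_not fun h => hab (hq _ _ h)
  split_ifs with hab
  · subst hab
    rw [PMF.map_apply, tsum_eq_single (a, a), if_pos rfl]
    rintro ⟨x, y⟩ hxy
    split_ifs with hax
    · exact hoff fun hxy' : x = y => hxy (by rw [← hxy', hax])
    · rfl
  · exact hoff hab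

variable [Fintype α]

theorem iidMass_eq_ite [DecidableEq α] (hq : ∀ x y : α, q (x, y) ≠ 0 → x = y) {n : ℕ}
    (x y : Fin n → α) :
    iidMass q x y = if x = y then (iid (q.map Prod.fst) n x).toReal else 0 := by
  simp only [iidMass, apply_eq_ite_map_fst hq]
  split_ifs with hxy
  · subst hxy
    simp only [if_true, toReal_iid]
  · obtain ⟨i, hi⟩ := Function.ne_iff.1 hxy
    exact prod_eq_zero (mem_univ i) (by rw [if_neg hi, ENNReal.toReal_zero])

theorem sum_abs_diag_le_l1Error (hq : ∀ x y : α, q (x, y) ≠ 0 → x = y) {n : ℕ} {R R₁ R₂ : ℝ}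
    (c : SimulationCode α α n R R₁ R₂) :
    ∑ x, |c.induced x x - (iid (q.map Prod.fst) n x).toReal| ≤ c.l1Error q := by
  classical
  refine sum_le_sum fun x _ => ?_
  have hdiag := single_le_sum (f := fun y => |c.induced x y - iidMass q x y|)
    (fun _ _ => abs_nonneg _) (mem_univ x)
  simpa only [iidMass_eq_ite hq x x, if_true] using hdiag

theorem Achievable.entropy_div_two_le (hq : ∀ x y : α, q (x, y) ≠ 0 → x = y) {R R₁ R₂ s : ℝ}
    (h : Achievable q R R₁ R₂)
    (hs : ∀ (n : ℕ) (c : SimulationCode α α n R R₁ R₂), ∑ x, √(c.induced x x) ≤ 2 ^ (n * s)) :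
    entropy (q.map Prod.fst) / 2 ≤ s := by
  obtain ⟨-, -, -, c, hc⟩ := h
  exact entropy_div_two_le_of_sum_sqrt_le _ (fun n x => (c n).induced_nonneg x x)
    (squeeze_zero (fun n => sum_nonneg fun x _ => abs_nonneg _)
      (fun n => sum_abs_diag_le_l1Error hq (c n)) hc) fun n => hs n (c n)

theorem sqrt_indexSize_mul_indexSize_le (n : ℕ) (R R' : ℝ) :
    √(indexSize n R * indexSize n R') ≤ 2 ^ (n * ((R + R') / 2)) := by
  rw [Real.sqrt_le_left (by positivity), ← Real.rpow_natCast, ← Real.rpow_mul two_pos.le]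
  refine (indexSize_mul_indexSize_le n R R').trans_eq ?_
  push_cast
  ring_nf

theorem Achievable.mem_region (hq : ∀ x y : α, q (x, y) ≠ 0 → x = y) {R R₁ R₂ : ℝ}
    (h : Achievable q R R₁ R₂) :
    0 ≤ R ∧ 0 ≤ R₁ ∧ 0 ≤ R₂ ∧ entropy (q.map Prod.fst) ≤ R + min R₁ R₂ ∧
      entropy (q.map Prod.fst) / 2 ≤ R := by
  have hmessage := h.entropy_div_two_le hq fun n c =>
    c.sum_sqrt_induced_le_message.trans (indexSize_le n R)
  have hprocessor₁ := h.entropy_div_two_le hq fun n c =>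
    c.sum_sqrt_induced_le_processor₁.trans (sqrt_indexSize_mul_indexSize_le n R R₁)
  have hprocessor₂ := h.entropy_div_two_le hq fun n c =>
    c.sum_sqrt_induced_le_processor₂.trans (sqrt_indexSize_mul_indexSize_le n R R₂)
  refine ⟨h.1, h.2.1, h.2.2.1, ?_, hmessage⟩
  rw [← min_add_add_left]
  exact le_min (by linarith) (by linarith)

end Diagonal

/-! ### Achievability -/

theorem indexSize_mono (n : ℕ) : Monotone (indexSize n) := fun _ _ h =>
  Nat.floor_le_floor (Real.rpow_le_rpow_of_exponent_le one_le_two (by gcongr))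

theorem inv_indexSize_le (n : ℕ) {R : ℝ} (hR : 0 ≤ R) :
    (indexSize n R : ℝ)⁻¹ ≤ 2 * 2 ^ (-(n * R)) := by
  have hpos : (1 : ℝ) ≤ indexSize n R := by exact_mod_cast indexSize_pos hR
  have hlt : (2 : ℝ) ^ (n * R) < indexSize n R + 1 := Nat.lt_floor_add_one _
  rw [Real.rpow_neg two_pos.le, ← div_eq_mul_inv, inv_le_comm₀ (by positivity) (by positivity),
    inv_div, div_le_iff₀ two_pos]
  linarith

theorem toReal_map_natCast_uniformOfFintype_le {N k : ℕ} [NeZero N] [NeZero k] (hkN : k ≤ N)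
    (g : ZMod k) :
    ((PMF.uniformOfFintype (Fin N)).map (fun w : Fin N => ((w : ℕ) : ZMod k)) g).toReal ≤
      2 / k := by
  have hk : (0 : ℝ) < k := by exact_mod_cast NeZero.pos k
  have hN : (0 : ℝ) < N := by exact_mod_cast NeZero.pos N
  have hcard : #{w : Fin N | ((w : ℕ) : ZMod k) = g} ≤ N / k + 1 := by
    rw [← card_range (N / k + 1)]
    refine card_le_card_of_injOn (fun w => (w : ℕ) / k)
      (fun w _ => ?_) fun w hw w' hw' (hdiv : (w : ℕ) / k = w' / k) => ?_
    · simpa [Nat.lt_succ_iff] using Nat.div_le_div_right (c := k) w.2.le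
    · have hmod : (w : ℕ) % k = w' % k := (ZMod.natCast_eq_natCast_iff' _ _ _).1
        ((mem_filter.1 hw).2.trans (mem_filter.1 hw').2.symm)
      ext
      rw [← Nat.div_add_mod (w : ℕ) k, hdiv, hmod, Nat.div_add_mod]
  have hcard' : (#{w : Fin N | ((w : ℕ) : ZMod k) = g} : ℝ) ≤ N / k + 1 :=
    (Nat.cast_le.2 hcard).trans (by push_cast; gcongr; exact Nat.cast_div_le)
  have hone : (1 : ℝ) ≤ N / k := (one_le_div hk).2 (by exact_mod_cast hkN)
  rw [toReal_map_uniformOfFintype, Fintype.expect_eq_sum_div_card, sum_boole, Fintype.card_fin,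
    div_le_iff₀ hN]
  linarith [show 2 / (k : ℝ) * N = N / k + N / k by ring]

namespace SimulationCode

variable {G V : Type*} [AddCommGroup G] [Fintype V] [Nonempty V] {n : ℕ} {R R₁ R₂ : ℝ}

/-- The code whose message encodes, through `e` with left inverse `d`, a uniform element of `V` and
the sum `π₁ W₁ + π₂ W₂`. Either processor subtracts its own summand, so that both know
`(π₁ W₁, π₂ W₂)`, and outputs the value of `f` at this pair and the element of `V`. -/
noncomputable def ofSum (π₁ : Index n R₁ → G) (π₂ : Index n R₂ → G) (e : V × G → Index n R)
    (d : Index n R → V × G) (f : G × G × V → Fin n → α) : SimulationCode α α n R R₁ R₂ where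
  coordinator w₁ w₂ := (PMF.uniformOfFintype V).map fun v => e (v, π₁ w₁ + π₂ w₂)
  processor₁ m w₁ := PMF.pure (f (π₁ w₁, (d m).2 - π₁ w₁, (d m).1))
  processor₂ m w₂ := PMF.pure (f ((d m).2 - π₂ w₂, π₂ w₂, (d m).1))

theorem ofSum_induced [DecidableEq α] [Nonempty (Index n R₁)] [Nonempty (Index n R₂)]
    (π₁ : Index n R₁ → G) (π₂ : Index n R₂ → G) {e : V × G → Index n R} {d : Index n R → V × G}
    (hde : Function.LeftInverse d e) (f : G × G × V → Fin n → α) (x y : Fin n → α) :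
    (ofSum π₁ π₂ e d f).induced x y =
      if x = y then (((PMF.uniformOfFintype (Index n R₁ × Index n R₂ × V)).map
        (f ∘ Prod.map π₁ (Prod.map π₂ id))) x).toReal else 0 := by
  rw [toReal_map_uniformOfFintype, ← univ_product_univ, ← univ_product_univ, expect_product]
  simp only [expect_product, induced_eq_expect, ofSum, mul_assoc, sum_toReal_map_mul,
    sum_toReal_uniformOfFintype_mul, hde _, add_sub_cancel_left, add_sub_cancel_right, toReal_pure]
  split_ifs with hxy
  · subst hxy
    simp only [ite_mul_ite, mul_one, mul_zero, eq_comm (a := x), Function.comp_apply, Prod.map, id]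
  · refine expect_eq_zero fun w₁ _ => expect_eq_zero fun w₂ _ => expect_eq_zero fun v _ => ?_
    rw [ite_zero_mul_ite_zero, if_neg fun h => hxy (h.1.trans h.2.symm)]

theorem exists_of_extractors [Fintype α] [Fintype G] [Nonempty (Index n R₁)]
    [Nonempty (Index n R₂)] (p : PMF (Fin n → α)) {π₁ : Index n R₁ → G} {π₂ : Index n R₂ → G}
    {δ₁ δ₂ : ℝ} (hδ₁ : ∀ g, ((PMF.uniformOfFintype (Index n R₁)).map π₁ g).toReal ≤ δ₁)
    (hδ₂ : ∀ g, ((PMF.uniformOfFintype (Index n R₂)).map π₂ g).toReal ≤ δ₂)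
    (hcard : Fintype.card V * Fintype.card G ≤ indexSize n R) :
    ∃ c : SimulationCode α α n R R₁ R₂, (∀ x y, x ≠ y → c.induced x y = 0) ∧
      ∑ x, |c.induced x x - (p x).toReal| ≤
        2 * ∑ x, min (δ₁ * (δ₂ * (Fintype.card V : ℝ)⁻¹)) (p x).toReal := by
  classical
  obtain ⟨e⟩ : Nonempty (V × G ↪ Index n R) :=
    Function.Embedding.nonempty_of_card_le (by simpa using hcard)
  obtain ⟨d, hd⟩ := e.injective.hasLeftInverse
  obtain ⟨f, hf⟩ := exists_sum_abs_map_sub_le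
    ((PMF.uniformOfFintype (Index n R₁ × Index n R₂ × V)).map (Prod.map π₁ (Prod.map π₂ id))) p
    (δ := δ₁ * (δ₂ * (Fintype.card V : ℝ)⁻¹)) fun ⟨g₁, g₂, v⟩ => by
      have hδ : 0 ≤ δ₁ := ENNReal.toReal_nonneg.trans (hδ₁ g₁)
      rw [toReal_map_prodMap_uniformOfFintype, toReal_map_prodMap_uniformOfFintype, PMF.map_id,
        PMF.uniformOfFintype_apply, ENNReal.toReal_inv, ENNReal.toReal_natCast]
      gcongr
      exacts [hδ₁ g₁, hδ₂ g₂]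
  refine ⟨ofSum π₁ π₂ e d f, fun x y hxy => by rw [ofSum_induced π₁ π₂ hd, if_neg hxy], ?_⟩
  simpa only [ofSum_induced π₁ π₂ hd, if_true, PMF.map_comp] using hf

theorem l1Error_eq_sum_abs_diag [Fintype α] {q : PMF (α × α)}
    (hq : ∀ x y : α, q (x, y) ≠ 0 → x = y) {c : SimulationCode α α n R R₁ R₂}
    (hc : ∀ x y, x ≠ y → c.induced x y = 0) :
    c.l1Error q = ∑ x, |c.induced x x - (iid (q.map Prod.fst) n x).toReal| := by
  classical
  simp only [l1Error, iidMass_eq_ite hq]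
  refine sum_congr rfl fun x _ => ?_
  rw [Fintype.sum_eq_single x fun y hxy => ?_, if_pos rfl]
  rw [hc x y hxy.symm, if_neg hxy.symm, sub_zero, abs_zero]

/-- Both sources are reduced modulo `⌊2^{nt}⌋`, and the uniform part of the message has rate `s`. -/
theorem exists_l1Error_le [Fintype α] {q : PMF (α × α)} (hq : ∀ x y : α, q (x, y) ≠ 0 → x = y)
    {s t : ℝ} (hs : 0 ≤ s) (ht : 0 ≤ t) (ht₁ : t ≤ R₁) (ht₂ : t ≤ R₂) (hst : s + t ≤ R) :
    ∃ c : SimulationCode α α n R R₁ R₂, c.l1Error q ≤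
      2 * ∑ x, min (32 * 2 ^ (-(n * (s + 2 * t)))) (iid (q.map Prod.fst) n x).toReal := by
  have : NeZero (indexSize n s) := ⟨(indexSize_pos hs).ne'⟩
  have : NeZero (indexSize n t) := ⟨(indexSize_pos ht).ne'⟩
  have : NeZero (indexSize n R₁) := ⟨(indexSize_pos (ht.trans ht₁)).ne'⟩
  have : NeZero (indexSize n R₂) := ⟨(indexSize_pos (ht.trans ht₂)).ne'⟩
  have hcard : Fintype.card (Index n s) * Fintype.card (ZMod (indexSize n t)) ≤ indexSize n R := by
    rw [Fintype.card_fin, ZMod.card]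
    refine le_trans (Nat.le_floor ?_) (indexSize_mono n hst)
    exact_mod_cast indexSize_mul_indexSize_le n s t
  obtain ⟨c, hoff, hc⟩ := exists_of_extractors (V := Index n s) (iid (q.map Prod.fst) n)
    (toReal_map_natCast_uniformOfFintype_le (indexSize_mono n ht₁))
    (toReal_map_natCast_uniformOfFintype_le (indexSize_mono n ht₂)) hcard
  refine ⟨c, (l1Error_eq_sum_abs_diag hq hoff).trans_le (hc.trans ?_)⟩
  gcongr 2 * ∑ x, min ?_ _
  have hs' := inv_indexSize_le n hs
  have ht' := inv_indexSize_le n ht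
  rw [Fintype.card_fin, div_eq_mul_inv]
  calc 2 * (indexSize n t : ℝ)⁻¹ * (2 * (indexSize n t : ℝ)⁻¹ * (indexSize n s : ℝ)⁻¹)
      ≤ 2 * (2 * 2 ^ (-(n * t))) * (2 * (2 * 2 ^ (-(n * t))) * (2 * 2 ^ (-(n * s)))) := by gcongr
    _ = 32 * (2 ^ (-(n * t)) * 2 ^ (-(n * t)) * 2 ^ (-(n * s))) := by ring
    _ = 32 * 2 ^ (-(n * (s + 2 * t))) := by
        rw [← Real.rpow_add two_pos, ← Real.rpow_add two_pos]
        ring_nf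

end SimulationCode

section RateRegion

variable [Fintype α] {q : PMF (α × α)} {R R₁ R₂ : ℝ}

theorem achievable_of_rate_splitting (hq : ∀ x y : α, q (x, y) ≠ 0 → x = y) {s t : ℝ}
    (hs : 0 ≤ s) (ht : 0 ≤ t) (ht₁ : t ≤ R₁) (ht₂ : t ≤ R₂) (hst : s + t ≤ R)
    (hH : entropy (q.map Prod.fst) < s + 2 * t) : Achievable q R R₁ R₂ := by
  choose c hc using fun n =>
    SimulationCode.exists_l1Error_le (n := n) hq hs ht ht₁ ht₂ hst
  have hlim := (tendsto_sum_min_iid (C := 32) _ hH (by norm_num)).const_mul 2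
  rw [mul_zero] at hlim
  exact ⟨(add_nonneg hs ht).trans hst, ht.trans ht₁, ht.trans ht₂, c, squeeze_zero
    (fun n => sum_nonneg fun x _ => sum_nonneg fun y _ => abs_nonneg _) hc hlim⟩

theorem achievable_of_lt (hq : ∀ x y : α, q (x, y) ≠ 0 → x = y) (hR : 0 ≤ R) (hR₁ : 0 ≤ R₁)
    (hR₂ : 0 ≤ R₂) (hmin : entropy (q.map Prod.fst) < R + min R₁ R₂)
    (hhalf : entropy (q.map Prod.fst) / 2 < R) : Achievable q R R₁ R₂ := by
  obtain ⟨htR, ht₁, ht₂⟩ : min R (min R₁ R₂) ≤ R ∧ min R (min R₁ R₂) ≤ R₁ ∧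
      min R (min R₁ R₂) ≤ R₂ := by simp
  refine achievable_of_rate_splitting hq (s := R - min R (min R₁ R₂)) (sub_nonneg.2 htR)
    (le_min hR (le_min hR₁ hR₂)) ht₁ ht₂ (sub_add_cancel _ _).le ?_
  rcases min_choice R (min R₁ R₂) with h | h <;> rw [h] <;> linarith

end RateRegion

end DistributedSampling

theorem mainTheorem12 {α : Type*} [Fintype α] (q : PMF (α × α))
    (hq : ∀ x y : α, q (x, y) ≠ 0 → x = y) :
    DistributedSampling.simulationRateRegion q =
      {r : ℝ × ℝ × ℝ | 0 ≤ r.1 ∧ 0 ≤ r.2.1 ∧ 0 ≤ r.2.2 ∧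
        DistributedSampling.entropy (q.map Prod.fst) ≤ r.1 + min r.2.1 r.2.2 ∧
        DistributedSampling.entropy (q.map Prod.fst) / 2 ≤ r.1} := by
  refine Set.Subset.antisymm (closure_minimal (fun r hr => hr.mem_region hq) ?_) ?_
  · simp only [Set.ofPred_and]
    refine IsClosed.inter ?_ (IsClosed.inter ?_ (IsClosed.inter ?_ (IsClosed.inter ?_ ?_))) <;>
      exact isClosed_le (by fun_prop) (by fun_prop)
  · rintro ⟨R, R₁, R₂⟩ ⟨hR, hR₁, hR₂, hmin, hhalf⟩
    have hlim : Tendsto (fun ε : ℝ => (R + ε, R₁, R₂)) (𝓝[>] 0) (𝓝 (R, R₁, R₂)) := by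
      have hcont : Continuous fun ε : ℝ => (R + ε, R₁, R₂) := by fun_prop
      simpa using (hcont.tendsto 0).mono_left nhdsWithin_le_nhds
    refine mem_closure_of_tendsto hlim (eventually_mem_nhdsWithin.mono fun ε (hε : 0 < ε) => ?_)
    exact DistributedSampling.achievable_of_lt hq (by linarith) hR₁ hR₂ (by linarith)
      (by linarith)
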